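/- Let $\phi$ be an entire function of exponential type, i.e. $|\phi(z)|\le Ce^{\tau|z|}$ on $\mathbb{C}$ for some $C,\tau>0$; let $\tau_\phi$ denote the infimum of the $\tau>0$ for which such a $C>0$ exists. The Borel transform of $\phi$ is $\mathcal{B}(\phi)(z)=\sum_{n\ge 0}\phi^{(n)}(0)\,z^{-n-1}$ for $|z|>\tau_\phi$. For $R>0$ put $B_R(0)=\{s\in\mathbb{C}:|s|<R\}$ and let $\mathrm{Exp}(B_R(0))$ be the set of entire functions $\phi$ of exponential type whose Borel transform has all its singularities in $B_R(0)$, that is, extends analytically to a neighbourhood of $\{|z|\ge R\}$; the extension is again denoted $\mathcal{B}(\phi)$. For $g\in\mathrm{Exp}(B_R(0))$ let $\mu_g$ be the complex measure $d\mu_g(s)=\mathcal{B}(g)(s)\,\frac{ds}{2\pi i}$ on the positively oriented circle $|s|=R$. **Theorem.** Let $h>1$ be real, let $0<R<\sqrt{h-1}$ and let $\zeta(s^2+h)=\sum_{k\ge 0}a_k(h)s^k$ be the Taylor expansion at $s=0$ (valid for $|s|<R$), where $\zeta$ is the Riemann zeta function. Let $g\in\mathrm{Exp}(B_R(0))$.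 Then a function $\phi\in\mathrm{Exp}(B_R(0))$, of exponential type $\tau_\phi$, is a solution of the infinite-order equation $$\sum_{k=0}^{\infty}a_k(h)\,\phi^{(k)}(t)=g(t)\qquad(t\in\mathbb{C})$$ if and only if there exist polynomials $p_k$, one for each zero $s_k\in B_R(0)$ of $s\mapsto\zeta(s^2+h)$, of degree less than the multiplicity of $s_k$, such that for all $t\in\mathbb{C}$ $$\phi(t)=\int_{|s|=R}\frac{e^{ts}}{\zeta(s^2+h)}\,d\mu_g(s)+\sum_{\substack{\zeta(s_k^2+h)=0\\ |s_k|<\tau_\phi}}p_k(t)\,e^{ts_k}.$$ -/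

import Mathlib

open Filter Topology

/-- `φ` is an entire function of (finite) exponential type: `|φ(z)| ≤ C e^{τ|z|}` on `ℂ`. -/
def IsExpType (φ : ℂ → ℂ) : Prop :=
  Differentiable ℂ φ ∧
    ∃ τ : ℝ, 0 < τ ∧ ∃ C : ℝ, 0 < C ∧ ∀ z : ℂ, ‖φ z‖ ≤ C * Real.exp (τ * ‖z‖)

/-- The exponential type `τ_φ`: the infimum of the `τ > 0` with `|φ(z)| ≤ C e^{τ|z|}` for
some `C > 0` and all `z`. -/
noncomputable def expType (φ : ℂ → ℂ) : ℝ :=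
  sInf {τ : ℝ | 0 < τ ∧ ∃ C : ℝ, 0 < C ∧ ∀ z : ℂ, ‖φ z‖ ≤ C * Real.exp (τ * ‖z‖)}

/-- The Borel transform `∑ aₙ n! / z^(n+1)` of `φ(z) = ∑ aₙ zⁿ`, where `aₙ n! = φ⁽ⁿ⁾(0)`; for `φ`
of exponential type the series converges on `|z| > τ_φ`. -/
noncomputable def borelSeries (φ : ℂ → ℂ) (z : ℂ) : ℂ :=
  ∑' n : ℕ, iteratedDeriv n φ 0 / z ^ (n + 1)

/-- `F` continues the Borel transform of `φ` analytically to (a neighbourhood of) the complement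
of `Ω`; near `∞` it is the Borel transform itself. -/
def IsBorelContinuation (Ω : Set ℂ) (φ F : ℂ → ℂ) : Prop :=
  AnalyticOnNhd ℂ F Ωᶜ ∧ ∀ z : ℂ, expType φ < ‖z‖ → F z = borelSeries φ z

/-- The space `Exp(Ω)`: entire functions of exponential type whose Borel transform has all its
singularities in `Ω`, i.e. continues analytically to the complement of `Ω`. -/
def ExpSpace (Ω : Set ℂ) : Set (ℂ → ℂ) :=
  {φ | IsExpType φ ∧ ∃ F : ℂ → ℂ, IsBorelContinuation Ω φ F}

/-- The (continued) Borel transform `𝓑(φ)` of `φ ∈ Exp(Ω)`. -/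
noncomputable def borelTransform (Ω : Set ℂ) (φ : ℂ → ℂ) : ℂ → ℂ :=
  Classical.epsilon (IsBorelContinuation Ω φ)

theorem borelTransform_spec {Ω : Set ℂ} {φ : ℂ → ℂ} (hφ : φ ∈ ExpSpace Ω) :
    IsBorelContinuation Ω φ (borelTransform Ω φ) :=
  Classical.epsilon_spec hφ.2

/-- On the complement of a disc the continued Borel transform is unique, so that the choice made
in `borelTransform` is immaterial there. -/
theorem IsBorelContinuation.eqOn_compl_ball {R : ℝ} {φ F G : ℂ → ℂ}
    (hF : IsBorelContinuation (Metric.ball 0 R) φ F)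
    (hG : IsBorelContinuation (Metric.ball 0 R) φ G) :
    Set.EqOn F G (Metric.ball 0 R)ᶜ := by
  have hpc : IsPreconnected ((Metric.ball (0 : ℂ) R)ᶜ) := by
    have hc : IsPreconnected ((fun q : ℝ × ℝ => (q.1 : ℂ) * Complex.exp (q.2 * Complex.I)) ''
        (Set.Ici (max R 0) ×ˢ Set.univ)) := by
      refine (isPreconnected_Ici.prod isPreconnected_univ).image _ ?_
      fun_prop
    convert hc using 1
    ext z
    simp only [Set.mem_compl_iff, Metric.mem_ball, dist_zero_right, not_lt, Set.mem_image,
      Set.mem_prod, Set.mem_Ici, Set.mem_univ, and_true, Prod.exists]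
    constructor
    · intro hz
      exact ⟨‖z‖, z.arg, max_le hz (norm_nonneg z), Complex.norm_mul_exp_arg_mul_I z⟩
    · rintro ⟨r, θ, hr, rfl⟩
      have h0 : 0 ≤ r := (le_max_right _ _).trans hr
      simpa [abs_of_nonneg h0] using (le_max_left _ _).trans hr
  obtain ⟨x, hx⟩ : ∃ x : ℝ, max |R| |expType φ| < x := exists_gt _
  have hx0 : 0 ≤ x := (abs_nonneg R).trans ((le_max_left _ _).trans hx.le)
  have hn : ‖(x : ℂ)‖ = x := by simp [abs_of_nonneg hx0]
  have hR : R < x := (le_abs_self R).trans_lt ((le_max_left _ _).trans_lt hx)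
  have hT : expType φ < x := (le_abs_self _).trans_lt ((le_max_right _ _).trans_lt hx)
  refine hF.1.eqOn_of_preconnected_of_eventuallyEq hG.1 hpc (z₀ := (x : ℂ)) ?_ ?_
  · simp only [Set.mem_compl_iff, Metric.mem_ball, dist_zero_right, hn, not_lt]
    exact hR.le
  · have hopen : ∀ᶠ z : ℂ in 𝓝 (x : ℂ), expType φ < ‖z‖ :=
      continuous_norm.continuousAt.eventually (lt_mem_nhds (by simpa only [hn] using hT))
    filter_upwards [hopen] with z hz
    rw [hF.2 z hz, hG.2 z hz]

/-- `∫_{|s|=R} F dμ_φ` for the complex measure `dμ_φ(s) = 𝓑(φ)(s) ds/(2πi)` carried by the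
positively oriented circle `|s| = R`, where `φ ∈ Exp(B_R(0))`. -/
noncomputable def circleBorelIntegral (R : ℝ) (φ F : ℂ → ℂ) : ℂ :=
  ∮ s in C(0, R), F s * (borelTransform (Metric.ball 0 R) φ s / (2 * Real.pi * Complex.I))

/-- The symbol `s ↦ ζ(s² + h)`. -/
noncomputable def zetaSymbol (h : ℝ) (s : ℂ) : ℂ := riemannZeta (s ^ 2 + h)

/-- The Taylor coefficients `a_k(h)` of `ζ(s² + h)` at `s = 0`. -/
noncomputable def zetaCoeff (h : ℝ) (k : ℕ) : ℂ :=
  iteratedDeriv k (zetaSymbol h) 0 / (k.factorial : ℂ)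

/-- `φ` solves `∑_{k ≥ 0} a_k(h) φ⁽ᵏ⁾ = g`: the partial sums converge to `g` at every point. -/
def SolvesZetaEquation (h : ℝ) (g φ : ℂ → ℂ) : Prop :=
  ∀ t : ℂ, Tendsto (fun n : ℕ => ∑ k ∈ Finset.range n, zetaCoeff h k * iteratedDeriv k φ t)
    atTop (𝓝 (g t))

/-! For |s| < √(h-1) the point s² + h has real part > 1, where ζ does not vanish. Since τ_φ ≤ R <
√(h-1), the sum over zeros is empty, and the claim reduces to inverting the operator. By the Pólya
representation (`IsBorelContinuation.eq_circleExpIntegral`), φ and g are integrals of e^{ts} over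
|s| = R against their Borel transforms. On such integrals a symbol holomorphic on a larger disc acts
by multiplying the density (`tendsto_sum_taylor_mul_iteratedDeriv`). Both ζ(s² + h) and its
reciprocal are such symbols, so they invert each other. -/

/-! ### Exponential integrals over a circle and operators acting on them. -/

/-- The Fourier–Borel type integral `t ↦ ∮_{|s| = R} e^{ts} f(s) ds`. -/
noncomputable def circleExpIntegral (R : ℝ) (f : ℂ → ℂ) (t : ℂ) : ℂ :=
  ∮ s in C(0, R), Complex.exp (t * s) * f s

theorem hasSum_circleIntegral_of_norm_le {R : ℝ} (hR : 0 ≤ R) {u : ℕ → ℝ} (hu : Summable u)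
    {F : ℕ → ℂ → ℂ} {f : ℂ → ℂ} (hF : ∀ n, ContinuousOn (F n) (Metric.sphere 0 R))
    (hFu : ∀ n, ∀ s ∈ Metric.sphere (0 : ℂ) R, ‖F n s‖ ≤ u n)
    (hf : ∀ s ∈ Metric.sphere (0 : ℂ) R, HasSum (fun n => F n s) (f s)) :
    HasSum (fun n => ∮ s in C(0, R), F n s) (∮ s in C(0, R), f s) := by
  have hlim : TendstoUniformlyOn (fun (t : Finset ℕ) s => ∑ n ∈ t, F n s) f atTop
      (Metric.sphere 0 R) :=
    (tendstoUniformlyOn_tsum hu hFu).congr_right fun s hs => (hf s hs).tsum_eq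
  have := hlim.tendsto_circleIntegral_of_continuousOn hR
    (Eventually.of_forall fun t => continuousOn_finsetSum t fun n _ => hF n)
  refine this.congr fun t => ?_
  exact circleIntegral.integral_fun_sum fun n _ => (hF n).circleIntegrable hR

theorem exists_norm_le_of_continuousOn_sphere {R : ℝ} {f : ℂ → ℂ}
    (hf : ContinuousOn f (Metric.sphere 0 R)) :
    ∃ M : ℝ, 0 ≤ M ∧ ∀ s ∈ Metric.sphere (0 : ℂ) R, ‖f s‖ ≤ M := by
  obtain ⟨M, hM⟩ := (isCompact_sphere (0 : ℂ) R).exists_bound_of_continuousOn hf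
  exact ⟨max M 0, le_max_right _ _, fun s hs => (hM s hs).trans (le_max_left _ _)⟩

theorem norm_exp_mul_le {R : ℝ} {s : ℂ} (hs : s ∈ Metric.sphere (0 : ℂ) R) (t : ℂ) :
    ‖Complex.exp (t * s)‖ ≤ Real.exp (R * ‖t‖) := by
  refine (Complex.norm_exp_le_exp_norm _).trans (Real.exp_le_exp.2 ?_)
  rw [norm_mul, mem_sphere_zero_iff_norm.1 hs, mul_comm]

theorem hasDerivAt_circleExpIntegral {R : ℝ} (hR : 0 ≤ R) {f : ℂ → ℂ}
    (hf : ContinuousOn f (Metric.sphere 0 R)) (t : ℂ) :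
    HasDerivAt (circleExpIntegral R f) (circleExpIntegral R (fun s => s * f s) t) t := by
  obtain ⟨M, hM0, hM⟩ := exists_norm_le_of_continuousOn_sphere hf
  have hmem : ∀ θ : ℝ, circleMap 0 R θ ∈ Metric.sphere (0 : ℂ) R := circleMap_mem_sphere 0 hR
  have hfc : Continuous fun θ : ℝ => f (circleMap 0 R θ) :=
    hf.comp_continuous (continuous_circleMap 0 R) hmem
  have hE : ∀ x : ℂ, Continuous fun θ : ℝ => Complex.exp (x * circleMap 0 R θ) :=
    fun x => by fun_prop
  have hI : Continuous fun θ : ℝ => circleMap 0 R θ * Complex.I := by fun_prop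
  have hc := continuous_circleMap 0 R
  unfold circleExpIntegral circleIntegral
  simp only [deriv_circleMap, smul_eq_mul]
  refine (intervalIntegral.hasDerivAt_integral_of_dominated_loc_of_deriv_le
    (s := Metric.ball t 1)
    -- The factors bound ds/dθ, the exponential for x in the unit ball around t, and s f(s).
    (bound := fun _ => R * (Real.exp (R * (‖t‖ + 1)) * (R * M)))
    (F' := fun x θ => circleMap 0 R θ * Complex.I *
      (Complex.exp (x * circleMap 0 R θ) * (circleMap 0 R θ * f (circleMap 0 R θ))))
    (Metric.ball_mem_nhds t one_pos) ?_ ?_ ?_ ?_ ?_ ?_).2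
  · exact Eventually.of_forall fun x => (hI.mul ((hE x).mul hfc)).aestronglyMeasurable
  · exact (hI.mul ((hE t).mul hfc)).intervalIntegrable _ _
  · exact (hI.mul ((hE t).mul (hc.mul hfc))).aestronglyMeasurable
  · refine Eventually.of_forall fun θ _ x hx => ?_
    have hn : ‖circleMap 0 R θ‖ = R := mem_sphere_zero_iff_norm.1 (hmem θ)
    have hx' : ‖x‖ ≤ ‖t‖ + 1 := by
      have h1 := norm_le_norm_add_norm_sub' x t
      have h2 := mem_ball_iff_norm.1 hx
      linarith
    rw [norm_mul, norm_mul, norm_mul, norm_mul, hn, Complex.norm_I, mul_one]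
    have h3 := hM _ (hmem θ)
    have h4 : ‖Complex.exp (x * circleMap 0 R θ)‖ ≤ Real.exp (R * (‖t‖ + 1)) :=
      (norm_exp_mul_le (hmem θ) x).trans (by gcongr)
    gcongr
  · exact intervalIntegrable_const
  · refine Eventually.of_forall fun θ _ x _ => ?_
    have h1 : HasDerivAt (fun x : ℂ => Complex.exp (x * circleMap 0 R θ))
        (Complex.exp (x * circleMap 0 R θ) * circleMap 0 R θ) x := by
      simpa using ((hasDerivAt_id x).mul_const (circleMap 0 R θ)).cexp
    convert! (h1.mul_const (f (circleMap 0 R θ))).const_mul (circleMap 0 R θ * Complex.I) using 1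
    ring

theorem iteratedDeriv_circleExpIntegral {R : ℝ} (hR : 0 ≤ R) {f : ℂ → ℂ}
    (hf : ContinuousOn f (Metric.sphere 0 R)) (n : ℕ) :
    iteratedDeriv n (circleExpIntegral R f) = circleExpIntegral R (fun s => s ^ n * f s) := by
  induction n with
  | zero => simp [iteratedDeriv_zero]
  | succ n ih =>
    ext t
    rw [iteratedDeriv_succ, ih,
      (hasDerivAt_circleExpIntegral hR (f := fun s => s ^ n * f s) (by fun_prop) t).deriv]
    congr 1
    ext s
    ring

theorem differentiable_circleExpIntegral {R : ℝ} (hR : 0 ≤ R) {f : ℂ → ℂ}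
    (hf : ContinuousOn f (Metric.sphere 0 R)) : Differentiable ℂ (circleExpIntegral R f) :=
  fun t => (hasDerivAt_circleExpIntegral hR hf t).differentiableAt

theorem circleExpIntegral_sub {R : ℝ} (hR : 0 ≤ R) {f k : ℂ → ℂ}
    (hf : ContinuousOn f (Metric.sphere 0 R)) (hk : ContinuousOn k (Metric.sphere 0 R)) (t : ℂ) :
    circleExpIntegral R (fun s => f s - k s) t =
      circleExpIntegral R f t - circleExpIntegral R k t := by
  have hexp : ContinuousOn (fun s : ℂ => Complex.exp (t * s)) (Metric.sphere 0 R) := by fun_prop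
  simp only [circleExpIntegral, mul_sub]
  exact circleIntegral.integral_sub ((hexp.mul hf).circleIntegrable hR)
    ((hexp.mul hk).circleIntegrable hR)

theorem expType_circleExpIntegral_le {R : ℝ} (hR : 0 < R) {f : ℂ → ℂ}
    (hf : ContinuousOn f (Metric.sphere 0 R)) : expType (circleExpIntegral R f) ≤ R := by
  obtain ⟨M, hM0, hM⟩ := exists_norm_le_of_continuousOn_sphere hf
  refine csInf_le ⟨0, fun τ hτ => hτ.1.le⟩
    -- The `+ 1` keeps the constant positive when M = 0.
    ⟨hR, 2 * Real.pi * R * M + 1, by positivity, fun t => ?_⟩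
  have h1 : ‖circleExpIntegral R f t‖ ≤ 2 * Real.pi * R * (Real.exp (R * ‖t‖) * M) := by
    refine circleIntegral.norm_integral_le_of_norm_le_const hR.le fun s hs => ?_
    rw [norm_mul]
    have h2 := hM s hs
    have h3 := norm_exp_mul_le hs t
    gcongr
  nlinarith [Real.exp_pos (R * ‖t‖)]

/-- An analytic symbol acts on exponential integrals as the infinite-order operator given by its
Taylor series. -/
theorem tendsto_sum_taylor_mul_iteratedDeriv {R ρ : ℝ} (hR : 0 ≤ R) (hRρ : R < ρ) {Z f : ℂ → ℂ}
    (hZ : DifferentiableOn ℂ Z (Metric.ball 0 ρ)) (hf : ContinuousOn f (Metric.sphere 0 R))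
    (t : ℂ) :
    Tendsto (fun n : ℕ => ∑ k ∈ Finset.range n,
        iteratedDeriv k Z 0 / (k.factorial : ℂ) * iteratedDeriv k (circleExpIntegral R f) t)
      atTop (𝓝 (circleExpIntegral R (fun s => Z s * f s) t)) := by
  obtain ⟨M, hM0, hM⟩ := exists_norm_le_of_continuousOn_sphere hf
  have hsum : ∀ z : ℂ, ‖z‖ < ρ →
      HasSum (fun k : ℕ => iteratedDeriv k Z 0 / (k.factorial : ℂ) * z ^ k) (Z z) := by
    intro z hz
    have := Complex.hasSum_taylorSeries_on_ball hZ (z := z) (by simpa using hz)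
    refine this.congr_fun fun k => ?_
    simp only [sub_zero, smul_eq_mul]
    ring
  -- Absolute convergence at the single point R < ρ gives the majorant for the whole circle |s| = R.
  have hnorm := (hsum (R : ℂ) (by simpa [abs_of_nonneg hR] using hRρ)).summable.norm
  refine HasSum.tendsto_sum_nat ?_
  simp_rw [iteratedDeriv_circleExpIntegral hR hf]
  have key := hasSum_circleIntegral_of_norm_le hR
    (hnorm.mul_right (Real.exp (R * ‖t‖) * M))
    (F := fun k s => iteratedDeriv k Z 0 / (k.factorial : ℂ) *
      (Complex.exp (t * s) * (s ^ k * f s)))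
    (f := fun s => Complex.exp (t * s) * (Z s * f s)) (fun n => by fun_prop) ?_ ?_
  · simpa only [circleIntegral.integral_const_mul] using! key
  · intro k s hs
    have h2 := hM s hs
    have h3 := norm_exp_mul_le hs t
    have h4 : ‖s‖ = R := mem_sphere_zero_iff_norm.1 hs
    simp only [norm_mul, norm_pow, h4, Complex.norm_real, Real.norm_eq_abs, abs_of_nonneg hR]
    calc _ = ‖iteratedDeriv k Z 0 / (k.factorial : ℂ)‖ * R ^ k *
          (‖Complex.exp (t * s)‖ * ‖f s‖) := by ring
      _ ≤ _ := by gcongr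
  · intro s hs
    have h4 : ‖s‖ = R := mem_sphere_zero_iff_norm.1 hs
    rw [mul_left_comm]
    refine ((hsum s (by rw [h4]; exact hRρ)).mul_right (Complex.exp (t * s) * f s)).congr_fun
      fun k => ?_
    ring

/-! ### Borel transform and Pólya representation. -/

/-- Cauchy's estimate on the circle of radius n/τ, which balances e^{τr} against r^{-n}, together
with n! ≤ nⁿ gives A = τe. -/
theorem IsExpType.exists_norm_iteratedDeriv_le {φ : ℂ → ℂ} (hφ : IsExpType φ) :
    ∃ A C : ℝ, 0 < A ∧ 0 < C ∧ ∀ n, ‖iteratedDeriv n φ 0‖ ≤ C * A ^ n := by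
  obtain ⟨hd, τ, hτ, C, hC, hb⟩ := hφ
  refine ⟨τ * Real.exp 1, C, by positivity, hC, fun n => ?_⟩
  -- The radius n/τ degenerates at n = 0.
  rcases Nat.eq_zero_or_pos n with rfl | hn
  · simpa using hb 0
  have hn' : (0 : ℝ) < n := by exact_mod_cast hn
  have h := Complex.norm_iteratedDeriv_le_of_forall_mem_sphere_norm_le (c := 0) (R := n / τ)
    (C := C * Real.exp n) n (by positivity) hd.diffContOnCl fun z hz => by
      have := hb z
      rwa [mem_sphere_zero_iff_norm.1 hz, mul_div_cancel₀ _ hτ.ne'] at this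
  have hfac : (n.factorial : ℝ) ≤ (n : ℝ) ^ n := by exact_mod_cast n.factorial_le_pow
  refine h.trans ?_
  rw [div_pow, div_div_eq_mul_div, div_le_iff₀ (by positivity), mul_pow, ← Real.exp_nat_mul,
    mul_one]
  calc (n.factorial : ℝ) * (C * Real.exp n) * τ ^ n ≤ (n : ℝ) ^ n * (C * Real.exp n) * τ ^ n := by
        gcongr
    _ = _ := by ring

theorem circleIntegral_pow_div_pow_succ {ρ : ℝ} (hρ : 0 < ρ) (n k : ℕ) :
    (∮ s in C(0, ρ), s ^ n / s ^ (k + 1)) = if k = n then 2 * Real.pi * Complex.I else 0 := by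
  have h : Set.EqOn (fun s : ℂ => s ^ n / s ^ (k + 1)) (fun s => (s - 0) ^ ((n : ℤ) - (k + 1)))
      (Metric.sphere 0 ρ) := by
    intro s hs
    have hs0 : s ≠ 0 := ne_zero_of_mem_sphere hρ.ne' ⟨s, hs⟩
    simp only [sub_zero]
    rw [zpow_sub₀ hs0]
    norm_cast
  rw [circleIntegral.integral_congr hρ.le h]
  split_ifs with hkn
  · subst hkn
    rw [← circleIntegral.integral_sub_center_inv 0 hρ.ne']
    congr 1
    ext s
    rw [show (k : ℤ) - (k + 1) = -1 by ring, zpow_neg_one]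
  · exact circleIntegral.integral_sub_zpow_of_ne (by omega) _ _ _

/-- The contour is pushed out to a radius ρ beyond both τ_φ and A: there F equals the Borel series,
which is dominated by a geometric series of ratio A/ρ, and termwise integration leaves only the
residue with k = n. -/
theorem IsBorelContinuation.circleIntegral_pow_mul {R : ℝ} (hR : 0 < R) {φ F : ℂ → ℂ}
    (hφ : IsExpType φ) (hF : IsBorelContinuation (Metric.ball 0 R) φ F) (n : ℕ) :
    (∮ s in C(0, R), s ^ n * F s) = 2 * Real.pi * Complex.I * iteratedDeriv n φ 0 := by
  obtain ⟨A, C, hA, hC, hb⟩ := hφ.exists_norm_iteratedDeriv_le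
  obtain ⟨ρ, hρ⟩ : ∃ ρ : ℝ, max (max R A) (expType φ) < ρ := exists_gt _
  simp only [max_lt_iff] at hρ
  obtain ⟨⟨hRρ, hAρ⟩, hTρ⟩ := hρ
  have hρ0 : 0 < ρ := hR.trans hRρ
  have hdiff : ∀ z : ℂ, R ≤ ‖z‖ → DifferentiableAt ℂ (fun s => s ^ n * F s) z := fun z hz =>
    (differentiableAt_id.pow n).mul (hF.1 z (by simpa using hz)).differentiableAt
  rw [← Complex.circleIntegral_eq_of_differentiable_on_annulus_off_countable hR hRρ.le
    Set.countable_empty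
    (fun z hz => (hdiff z (by simpa using hz.2)).continuousAt.continuousWithinAt)
    (fun z hz => hdiff z (by
      have := hz.1.2
      simp only [Metric.mem_closedBall, dist_zero_right, not_le] at this
      exact this.le))]
  have hcont : ∀ k : ℕ, ContinuousOn (fun s : ℂ => s ^ n / s ^ (k + 1)) (Metric.sphere 0 ρ) :=
    fun k => (by fun_prop : ContinuousOn (fun s : ℂ => s ^ n) _).div (by fun_prop) fun s hs =>
      pow_ne_zero _ (ne_zero_of_mem_sphere hρ0.ne' ⟨s, hs⟩)
  have hgeom : Summable fun k : ℕ => ρ ^ n * C / ρ * (A / ρ) ^ k :=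
    (summable_geometric_of_lt_one (by positivity) ((div_lt_one hρ0).2 hAρ)).mul_left _
  have hbound : ∀ k : ℕ, ∀ s ∈ Metric.sphere (0 : ℂ) ρ,
      ‖iteratedDeriv k φ 0 * (s ^ n / s ^ (k + 1))‖ ≤ ρ ^ n * C / ρ * (A / ρ) ^ k := by
    intro k s hs
    rw [norm_mul, norm_div, norm_pow, norm_pow, mem_sphere_zero_iff_norm.1 hs]
    calc _ ≤ C * A ^ k * (ρ ^ n / ρ ^ (k + 1)) := by gcongr; exact hb k
      _ = _ := by rw [div_pow]; field_simp; rw [pow_succ']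
  have key := hasSum_circleIntegral_of_norm_le hρ0.le hgeom
    (F := fun k s => iteratedDeriv k φ 0 * (s ^ n / s ^ (k + 1))) (f := fun s => s ^ n * F s)
    (fun k => continuousOn_const.mul (hcont k)) hbound fun s hs => by
      have h1 := (Summable.of_norm_bounded hgeom fun k => hbound k s hs).hasSum
      convert! h1 using 1
      rw [hF.2 s (by rwa [mem_sphere_zero_iff_norm.1 hs]), borelSeries, ← tsum_mul_left]
      congr 1
      ext k
      ring
  simp only [circleIntegral.integral_const_mul, circleIntegral_pow_div_pow_succ hρ0] at key
  refine key.unique ?_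
  convert hasSum_ite_eq n (2 * Real.pi * Complex.I * iteratedDeriv n φ 0) using 1
  ext k
  split_ifs with hk
  · rw [hk]; ring
  · simp

theorem Differentiable.eq_of_iteratedDeriv_zero_eq {φ ψ : ℂ → ℂ} (hφ : Differentiable ℂ φ)
    (hψ : Differentiable ℂ ψ) (h : ∀ n, iteratedDeriv n φ 0 = iteratedDeriv n ψ 0) : φ = ψ := by
  ext t
  rw [← Complex.taylorSeries_eq_of_entire hφ 0 t, ← Complex.taylorSeries_eq_of_entire hψ 0 t]
  simp only [h]

theorem IsBorelContinuation.continuousOn_sphere {R : ℝ} {φ F : ℂ → ℂ}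
    (hF : IsBorelContinuation (Metric.ball 0 R) φ F) : ContinuousOn F (Metric.sphere 0 R) :=
  hF.1.continuousOn.mono fun s hs => by simp [mem_sphere_zero_iff_norm.1 hs]

/-- The Pólya representation of a function of exponential type through its Borel transform. -/
theorem IsBorelContinuation.eq_circleExpIntegral {R : ℝ} (hR : 0 < R) {φ F : ℂ → ℂ}
    (hφ : IsExpType φ) (hF : IsBorelContinuation (Metric.ball 0 R) φ F) :
    φ = circleExpIntegral R (fun s => F s / (2 * Real.pi * Complex.I)) := by
  have hc : ContinuousOn (fun s => F s / (2 * Real.pi * Complex.I)) (Metric.sphere 0 R) :=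
    hF.continuousOn_sphere.div_const _
  refine hφ.1.eq_of_iteratedDeriv_zero_eq (differentiable_circleExpIntegral hR.le hc) fun n => ?_
  rw [iteratedDeriv_circleExpIntegral hR.le hc, circleExpIntegral]
  have hpi := Complex.two_pi_I_ne_zero
  have h := hF.circleIntegral_pow_mul hR hφ n
  calc iteratedDeriv n φ 0
      = (2 * Real.pi * Complex.I)⁻¹ * (2 * Real.pi * Complex.I * iteratedDeriv n φ 0) := by
        rw [inv_mul_cancel_left₀ hpi]
    _ = _ := by
        rw [← h, ← circleIntegral.integral_const_mul]
        congr 1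
        ext s
        simp only [zero_mul, Complex.exp_zero, one_mul]
        ring

/-! ### The zeta symbol and the inversion of its operator. -/

theorem one_lt_re_sq_add {h : ℝ} {s : ℂ} (hs : ‖s‖ < Real.sqrt (h - 1)) :
    1 < (s ^ 2 + h : ℂ).re := by
  have h1 : ‖s‖ ^ 2 < h - 1 := (Real.lt_sqrt (norm_nonneg s)).1 hs
  have h2 : -(s ^ 2).re ≤ ‖s‖ ^ 2 := by
    rw [← norm_pow]
    exact (neg_le_abs _).trans (Complex.abs_re_le_norm _)
  rw [Complex.add_re, Complex.ofReal_re]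
  linarith

theorem zetaSymbol_ne_zero {h : ℝ} {s : ℂ} (hs : ‖s‖ < Real.sqrt (h - 1)) : zetaSymbol h s ≠ 0 :=
  riemannZeta_ne_zero_of_one_lt_re (one_lt_re_sq_add hs)

theorem differentiableOn_zetaSymbol (h : ℝ) :
    DifferentiableOn ℂ (zetaSymbol h) (Metric.ball 0 (Real.sqrt (h - 1))) := by
  intro s hs
  have hne : s ^ 2 + h ≠ (1 : ℂ) := fun h1 => by
    have := one_lt_re_sq_add (mem_ball_zero_iff.1 hs)
    rw [h1, Complex.one_re] at this
    exact lt_irrefl _ this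
  exact ((differentiableAt_riemannZeta hne).comp s
    (by fun_prop : DifferentiableAt ℂ (fun s : ℂ => s ^ 2 + h) s)).differentiableWithinAt

/-- `ζ(∂² + h)` is invertible on exponential integrals over `|s| = R`, and its inverse is the
multiplication of the density by `1 / ζ(s² + h)`. -/
theorem solvesZetaEquation_iff_eq_circleExpIntegral_div {h R : ℝ} (hR0 : 0 ≤ R)
    (hR : R < Real.sqrt (h - 1)) {f k : ℂ → ℂ} (hf : ContinuousOn f (Metric.sphere 0 R))
    (hk : ContinuousOn k (Metric.sphere 0 R)) :
    SolvesZetaEquation h (circleExpIntegral R k) (circleExpIntegral R f) ↔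
      ∀ t, circleExpIntegral R f t = circleExpIntegral R (fun s => k s / zetaSymbol h s) t := by
  have hlt : ∀ s ∈ Metric.sphere (0 : ℂ) R, ‖s‖ < Real.sqrt (h - 1) := fun s hs => by
    rwa [mem_sphere_zero_iff_norm.1 hs]
  have hZd := differentiableOn_zetaSymbol h
  have hZc : ContinuousOn (zetaSymbol h) (Metric.sphere 0 R) :=
    hZd.continuousOn.mono fun s hs => mem_ball_zero_iff.2 (hlt s hs)
  have hZ0 : ∀ s ∈ Metric.sphere (0 : ℂ) R, zetaSymbol h s ≠ 0 := fun s hs =>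
    zetaSymbol_ne_zero (hlt s hs)
  have hkZ : ContinuousOn (fun s => k s / zetaSymbol h s) (Metric.sphere 0 R) := hk.div hZc hZ0
  constructor
  · intro hsol t
    have hD : ContinuousOn (fun s => zetaSymbol h s * f s - k s) (Metric.sphere 0 R) :=
      (hZc.mul hf).sub hk
    -- Densities are not unique, so D itself need not vanish on the circle; only its exponential
    -- integral does.
    have hD0 : circleExpIntegral R (fun s => zetaSymbol h s * f s - k s) = 0 := by
      ext t
      rw [circleExpIntegral_sub hR0 (f := fun s => zetaSymbol h s * f s) (hZc.mul hf) hk,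
        tendsto_nhds_unique (hsol t)
        (tendsto_sum_taylor_mul_iteratedDeriv hR0 hR hZd hf t), Pi.zero_apply]
      exact sub_self _
    have hinv : DifferentiableOn ℂ (fun s => (zetaSymbol h s)⁻¹)
        (Metric.ball 0 (Real.sqrt (h - 1))) :=
      hZd.inv fun s hs => zetaSymbol_ne_zero (mem_ball_zero_iff.1 hs)
    -- The operator with symbol 1/ζ(s² + h) sends this zero function to the integral with density
    -- D/ζ(s² + h) = f - k/ζ(s² + h), which is therefore zero.
    have h2 := tendsto_sum_taylor_mul_iteratedDeriv hR0 hR hinv hD t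
    have hz : ∀ n, iteratedDeriv n (0 : ℂ → ℂ) t = 0 := fun n => by simp [Pi.zero_def]
    simp only [hD0, hz, mul_zero, Finset.sum_const_zero] at h2
    have h3 := tendsto_nhds_unique h2 tendsto_const_nhds
    rw [← sub_eq_zero, ← circleExpIntegral_sub hR0 hf hkZ, ← h3]
    refine circleIntegral.integral_congr hR0 fun s hs => ?_
    have := hZ0 s hs
    simp only
    field_simp
  · intro heq t
    rw [funext heq]
    refine (tendsto_sum_taylor_mul_iteratedDeriv hR0 hR hZd hkZ t).trans_eq (congrArg 𝓝 ?_)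
    refine circleIntegral.integral_congr hR0 fun s hs => ?_
    have := hZ0 s hs
    simp only
    field_simp

theorem expType_le_of_mem_expSpace {R : ℝ} (hR : 0 < R) {φ : ℂ → ℂ}
    (hφ : φ ∈ ExpSpace (Metric.ball 0 R)) : expType φ ≤ R := by
  have hF := borelTransform_spec hφ
  rw [hF.eq_circleExpIntegral hR hφ.1]
  exact expType_circleExpIntegral_le hR (hF.continuousOn_sphere.div_const _)

theorem mainTheorem10 (h : ℝ) (hh : 1 < h) (R : ℝ) (hR0 : 0 < R) (hR : R < Real.sqrt (h - 1))
    (g : ℂ → ℂ) (hg : g ∈ ExpSpace (Metric.ball 0 R))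
    (φ : ℂ → ℂ) (hφ : φ ∈ ExpSpace (Metric.ball 0 R)) :
    SolvesZetaEquation h g φ ↔
      ∃ p : ℂ → Polynomial ℂ,
        (∀ s ∈ Metric.ball (0 : ℂ) R, zetaSymbol h s = 0 →
          (p s).degree < (analyticOrderNatAt (zetaSymbol h) s : WithBot ℕ)) ∧
        ∀ t : ℂ, φ t =
          circleBorelIntegral R g (fun s => Complex.exp (t * s) / zetaSymbol h s) +
            ∑ᶠ s ∈ {s : ℂ | zetaSymbol h s = 0 ∧ ‖s‖ < expType φ},
              (p s).eval t * Complex.exp (t * s) := by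
  have hzeros : {s : ℂ | zetaSymbol h s = 0 ∧ ‖s‖ < expType φ} = ∅ := by
    refine Set.eq_empty_of_forall_notMem fun s hs => zetaSymbol_ne_zero ?_ hs.1
    exact hs.2.trans ((expType_le_of_mem_expSpace hR0 hφ).trans_lt hR)
  have hFφ := borelTransform_spec hφ
  have hFg := borelTransform_spec hg
  have hiff := solvesZetaEquation_iff_eq_circleExpIntegral_div hR0.le hR
    (hFφ.continuousOn_sphere.div_const (2 * Real.pi * Complex.I))
    (hFg.continuousOn_sphere.div_const (2 * Real.pi * Complex.I))
  rw [← hFφ.eq_circleExpIntegral hR0 hφ.1, ← hFg.eq_circleExpIntegral hR0 hg.1] at hiff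
  have hint : ∀ t : ℂ, circleBorelIntegral R g (fun s => Complex.exp (t * s) / zetaSymbol h s) =
      circleExpIntegral R (fun s => borelTransform (Metric.ball 0 R) g s /
        (2 * Real.pi * Complex.I) / zetaSymbol h s) t := fun t => by
    unfold circleBorelIntegral circleExpIntegral
    congr 1
    ext s
    ring
  simp only [hzeros, Set.mem_empty_iff_false, finsum_false, finsum_zero, add_zero, hint]
  rw [hiff]
  -- Any polynomials would do: the symbol has no zeros in the disc, so the degree condition is
  -- vacuous.
  refine ⟨fun heq => ⟨0, fun s hs h0 => ?_, heq⟩, fun ⟨_, _, heq⟩ => heq⟩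
  exact absurd h0 (zetaSymbol_ne_zero ((mem_ball_zero_iff.1 hs).trans hR))
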